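/- Let $d,s$ be positive integers with $s>d/2$. Let $W^s_2(\mathbb R^d)$ be the Sobolev space of complex-valued functions $f$ whose weak derivatives $D^\alpha f$ with $|\alpha|_1\le s$ all belong to $L_2(\mathbb R^d)$, with the inner product $\langle f,g\rangle=\sum_{|\alpha|_1\le s}\int_{\mathbb R^d}D^\alpha f(x)\,\overline{D^\alpha g(x)}\,dx$; since $s>d/2$, its elements are identified with their continuous representatives. Let $\rho$ be a probability density on $\mathbb R^d$ and $S_\rho(f)=\int_{\mathbb R^d}f(x)\rho(x)\,dx$ for $f\in W^s_2(\mathbb R^d)$. The worst case error of an algorithm $A$ is $e(A)=\sup\{|S_\rho(f)-A(f)| : f\in W^s_2(\mathbb R^d),\ \|f\|_{W^s_2(\mathbb R^d)}\le 1\}$. For $\varepsilon>0$ let $n(\varepsilon,d)=n(\varepsilon,d,s,\rho)$ be the minimal $n\ge 0$ for which some algorithm of the form $A(f)=\Phi(f(x_1),\dots,f(x_n))$, with points $x_j\in\mathbb R^d$ and an arbitrary map $\Phi:\mathbb C^n\to\mathbb C$, has $e(A)\le\varepsilon$. Theorem. (i) The integral $S_\rho(f)$ converges absolutely for every $f\in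 W^s_2(\mathbb R^d)$, and for every $n\ge 1$ there exist points $x_1^*,\dots,x_n^*\in\mathbb R^d$ such that the QMC algorithm $f\mapsto\frac1n\sum_{j=1}^n f(x_j^*)$ has worst case error at most $\frac{10.03}{\sqrt n}\left(\frac6{11}\right)^d$. (ii) For every $\varepsilon>0$, $n(\varepsilon,d)\le\left\lceil 100.6009\left(\frac6{11}\right)^{2d}\frac1{\varepsilon^2}\right\rceil$. (iii) Consequently there is a constant $C\ge 0$, independent of $d$, $s$ and $\rho$, with $n(\varepsilon,d)\le C\varepsilon^{-2}$ for all $\varepsilon\in(0,1)$; and for every choice, for each $d\ge1$, of an integer $s_d>d/2$ and a probability density $\rho_d$ on $\mathbb R^d$, the integration problem is strongly polynomially tractable for the absolute error criterion, that is, there are $C,p\ge 0$ with $n(\varepsilon,d)\le C\varepsilon^{-p}$ for all $d\ge 1$ and $\varepsilon\in(0,1)$. -/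

import Mathlib

open MeasureTheory
open scoped ENNReal ContDiff ComplexConjugate

noncomputable section

/-- The space `ℝ^d` with its Euclidean structure and Lebesgue measure. -/
abbrev Rd (d : ℕ) : Type := EuclideanSpace ℝ (Fin d)

/-- The classical partial derivative `∂ φ / ∂ x_i`. -/
def partialDeriv {d : ℕ} (i : Fin d) (φ : Rd d → ℂ) : Rd d → ℂ :=
  fun x => lineDeriv ℝ φ x (EuclideanSpace.single i 1)

/-- The classical derivative `∂_1^{α_1} ⋯ ∂_d^{α_d} φ`, used only for smooth test functions. -/
def multiDeriv {d : ℕ} (α : Fin d → ℕ) (φ : Rd d → ℂ) : Rd d → ℂ :=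
  (List.finRange d).foldr (fun i ψ => (partialDeriv i)^[α i] ψ) φ

/-- The multi-indices `α ∈ ℕ^d` with `|α|_1 ≤ s`. -/
def multiIndices (d s : ℕ) : Finset (Fin d → ℕ) :=
  (Fintype.piFinset fun _ => Finset.range (s + 1)).filter fun α => ∑ j, α j ≤ s

theorem mem_multiIndices {d s : ℕ} {α : Fin d → ℕ} :
    α ∈ multiIndices d s ↔ ∑ j, α j ≤ s := by
  simp only [multiIndices, Finset.mem_filter, Fintype.mem_piFinset, Finset.mem_range,
    and_iff_right_iff_imp]
  intro h j
  exact Nat.lt_succ_of_le ((Finset.single_le_sum (fun i _ => Nat.zero_le (α i))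
    (Finset.mem_univ j)).trans h)

/-- `g` is the weak derivative `D^α f`: integration by parts holds against all smooth
compactly supported test functions. -/
def IsWeakDeriv {d : ℕ} (α : Fin d → ℕ) (f g : Rd d → ℂ) : Prop :=
  ∀ φ : Rd d → ℂ, ContDiff ℝ ∞ φ → HasCompactSupport φ →
    ∫ x, f x * multiDeriv α φ x = (-1) ^ (∑ j, α j) * ∫ x, g x * φ x

/-- `f` has a square integrable weak derivative `D^α f`. -/
def HasL2WeakDeriv {d : ℕ} (α : Fin d → ℕ) (f : Rd d → ℂ) : Prop :=
  ∃ g : Rd d → ℂ, MemLp g 2 volume ∧ IsWeakDeriv α f g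

open Classical in
/-- A version of the square integrable weak derivative `D^α f`
(unique up to a null set when it exists). -/
def weakDeriv {d : ℕ} (α : Fin d → ℕ) (f : Rd d → ℂ) : Rd d → ℂ :=
  if h : HasL2WeakDeriv α f then h.choose else 0

/-- The Sobolev space `W^s_2(ℝ^d)` in the case `s > d/2`, where every class has exactly one
continuous representative: the continuous functions `f` with `D^α f ∈ L_2` for all `|α|_1 ≤ s`
(for `α = 0` this says `f ∈ L_2`). -/
def sobolevSpace (d s : ℕ) : Set (Rd d → ℂ) :=
  {f | Continuous f ∧ ∀ α ∈ multiIndices d s, HasL2WeakDeriv α f}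

/-- The inner product `∑_{|α|_1 ≤ s} ⟨D^α f, D^α g⟩_{L_2}`, linear in the first variable. -/
def sobolevInner (d s : ℕ) (f g : Rd d → ℂ) : ℂ :=
  ∑ α ∈ multiIndices d s, ∫ x, weakDeriv α f x * conj (weakDeriv α g x)

/-- The norm of `W^s_2(ℝ^d)` induced by `sobolevInner`. -/
def sobolevNorm (d s : ℕ) (f : Rd d → ℂ) : ℝ :=
  √(sobolevInner d s f f).re

/-- The closed unit ball of `W^s_2(ℝ^d)`. -/
def sobolevUnitBall (d s : ℕ) : Set (Rd d → ℂ) :=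
  {f | f ∈ sobolevSpace d s ∧ sobolevNorm d s f ≤ 1}

/-- `ρ` is a probability density on `ℝ^d`. -/
structure IsProbDensity {d : ℕ} (ρ : Rd d → ℝ) : Prop where
  nonneg : ∀ x, 0 ≤ ρ x
  integrable : Integrable ρ volume
  integral_eq_one : ∫ x, ρ x = 1

/-- The integration functional `S_ρ(f) = ∫ f(x) ρ(x) dx`. -/
def weightedIntegral {d : ℕ} (ρ : Rd d → ℝ) (f : Rd d → ℂ) : ℂ :=
  ∫ x, f x * (ρ x : ℂ)

/-- The worst case (absolute) error of an algorithm `A` for `S_ρ` over the unit ball of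
`W^s_2(ℝ^d)`, as an extended nonnegative number. -/
def worstCaseError {d : ℕ} (s : ℕ) (ρ : Rd d → ℝ) (A : (Rd d → ℂ) → ℂ) : ℝ≥0∞ :=
  ⨆ f ∈ sobolevUnitBall d s, ‖weightedIntegral ρ f - A f‖ₑ

/-- The QMC algorithm `f ↦ (1/n) ∑_j f(x_j)`. -/
def qmc {d n : ℕ} (x : Fin n → Rd d) (f : Rd d → ℂ) : ℂ :=
  (1 / (n : ℂ)) * ∑ j, f (x j)

/-- The algorithm `A` uses `n` function values: `A(f) = Φ(f(x_1), …, f(x_n))` for some points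
`x_j` and an arbitrary (not necessarily linear) map `Φ`. -/
def UsesFunctionValues {d : ℕ} (n : ℕ) (A : (Rd d → ℂ) → ℂ) : Prop :=
  ∃ (x : Fin n → Rd d) (Φ : (Fin n → ℂ) → ℂ), ∀ f, A f = Φ fun j => f (x j)

/-- The information complexity `n(ε, W^s_2(ℝ^d))` of `S_ρ` for the absolute error criterion:
the minimal number of function values used by an algorithm with worst case error at most `ε`
(`⊤` if there is none). -/
def infoComplexity {d : ℕ} (s : ℕ) (ρ : Rd d → ℝ) (ε : ℝ) : ℕ∞ :=
  ⨅ (n : ℕ) (_ : ∃ A : (Rd d → ℂ) → ℂ, UsesFunctionValues n A ∧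
    worstCaseError s ρ A ≤ ENNReal.ofReal ε), (n : ℕ∞)

/-- Strong polynomial tractability of a family of problems indexed by the dimension `d ≥ 1`, with
information complexities `N d ε`: `N d ε ≤ C ε^{-p}` with `C`, `p` independent of `d` and `ε`. -/
def StronglyPolynomiallyTractable (N : ℕ → ℝ → ℕ∞) : Prop :=
  ∃ C p : ℝ, 0 ≤ C ∧ 0 ≤ p ∧ ∀ d : ℕ, 1 ≤ d → ∀ ε : ℝ, 0 < ε → ε < 1 →
    (N d ε : ℝ≥0∞) ≤ ENNReal.ofReal (C * ε ^ (-p))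

end

/-!
On the frequency side `W^s_2(ℝ^d)` is `L_2` with the weight `v(u) = ∑_{|α|_1 ≤ s} (2 π u)^{2 α}`
(`sobolevSymbol`). Since `1 / v` is integrable for `s > d / 2`, Fourier inversion turns evaluation
at `x` into the inner product with a vector `E x ∈ L_2` (`evalFeature`), whose squared norm
`K = ∫ 1 / v` does not depend on `x`; this is `exists_eq_inner_evalFeature`. Integration against
`ρ` is then the inner product with the mean `m` of `E` under `ρ`, and the worst case error of a QMC
algorithm is at most the distance from `m` to the average of the vectors `E (x_j)`. Choosing the
points one after another, each at least as good as the average point, gives points for which this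
distance is at most `√(K / n)` (`exists_norm_sum_sub_integral_sq_le`).

It remains to bound `K` (`integrable_inv_sobolevSymbol_and_integral_le`). Multinomial coefficients
of degree `k` are at most `k!`, so `v(u) ≥ ∑_{k ≤ s} (2 π ‖u‖)^{2k} / k!`. Only two of these terms
are kept, of degrees `k > m` with `k + m = d` and `k - m ∈ {1, 2}`; in polar coordinates the
integral becomes an arctangent, and `K ≤ π (d + 1) (2 √π)^{-d} ≤ 100.6009 (6 / 11)^{2d}`.

The identification of the weight needs the Fourier transform of a weak derivative, where test
functions are smooth with compact support. Raising one entry of `α` at a time, the question is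
reduced to first order derivatives; there a cutoff argument (`integral_mul_lineDeriv_schwartz`)
admits Schwartz test functions, and the calculus of tempered distributions applies.
-/

open scoped SchwartzMap LineDeriv FourierTransform

/-! ### The symbol of the Sobolev norm and the integral of its inverse -/

/-- The sum over `|α|_1 ≤ s` of `|(2 π i u)^α|^2`, the squared modulus of the Fourier symbol of the
derivative `D^α`. -/
noncomputable def sobolevSymbol {d : ℕ} (s : ℕ) (u : Rd d) : ℝ :=
  ∑ α ∈ multiIndices d s, ∏ j, ((2 * Real.pi * u j) ^ 2) ^ α j

theorem one_le_sobolevSymbol {d : ℕ} (s : ℕ) (u : Rd d) : 1 ≤ sobolevSymbol s u := by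
  have h0 : (0 : Fin d → ℕ) ∈ multiIndices d s := mem_multiIndices.2 (by simp)
  have := Finset.single_le_sum
    (f := fun α : Fin d → ℕ => ∏ j, ((2 * Real.pi * u j) ^ 2) ^ α j)
    (fun α _ => Finset.prod_nonneg fun j _ => by positivity) h0
  simpa [sobolevSymbol] using this

theorem sobolevSymbol_pos {d : ℕ} (s : ℕ) (u : Rd d) : 0 < sobolevSymbol s u :=
  one_pos.trans_le (one_le_sobolevSymbol s u)

theorem continuous_sobolevSymbol {d : ℕ} (s : ℕ) :
    Continuous (sobolevSymbol s : Rd d → ℝ) := by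
  unfold sobolevSymbol
  fun_prop

/-- Multinomial coefficients are at most `k!`, so the complete homogeneous polynomial of degree `k`
dominates the `k`-th power of the sum divided by `k!`. -/
theorem sum_pow_div_factorial_le {ι : Type*} [Fintype ι] [DecidableEq ι] {y : ι → ℝ}
    (hy : ∀ i, 0 ≤ y i) (k : ℕ) :
    (∑ i, y i) ^ k / k.factorial ≤ ∑ α ∈ Finset.univ.piAntidiag k, ∏ i, y i ^ α i := by
  rw [div_le_iff₀ (by positivity), Finset.sum_pow_eq_sum_piAntidiag, Finset.sum_mul]
  refine Finset.sum_le_sum fun α hα => ?_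
  rw [mul_comm]
  refine mul_le_mul_of_nonneg_left ?_ (Finset.prod_nonneg fun i _ => pow_nonneg (hy i) _)
  have h := Nat.multinomial_spec Finset.univ α
  rw [(Finset.mem_piAntidiag.1 hα).1] at h
  rw [← h]
  exact_mod_cast Nat.le_mul_of_pos_left _ (Finset.prod_pos fun i _ => Nat.factorial_pos _)

/-- Two homogeneous parts of the symbol are enough: one controls large frequencies, the other
small ones. -/
theorem norm_pow_add_norm_pow_le_sobolevSymbol {d s k m : ℕ} (hk : k ≤ s) (hm : m ≤ s)
    (hkm : k ≠ m) (u : Rd d) :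
    (2 * Real.pi * ‖u‖) ^ (2 * k) / k.factorial + (2 * Real.pi * ‖u‖) ^ (2 * m) / m.factorial
      ≤ sobolevSymbol s u := by
  have hsum : ∑ j, (2 * Real.pi * u j) ^ 2 = (2 * Real.pi * ‖u‖) ^ 2 := by
    simp only [mul_pow, EuclideanSpace.real_norm_sq_eq, Finset.mul_sum]
  have key := fun k => sum_pow_div_factorial_le (y := fun j => (2 * Real.pi * u j) ^ 2)
    (fun j => by positivity) k
  simp only [hsum, ← pow_mul] at key
  refine (add_le_add (key k) (key m)).trans ?_
  rw [← Finset.sum_union]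
  · simp only [sobolevSymbol, ← pow_mul]
    refine Finset.sum_le_sum_of_subset_of_nonneg ?_
      fun α _ _ => Finset.prod_nonneg fun j _ => ?_
    · intro α hα
      rw [Finset.mem_union, Finset.mem_piAntidiag, Finset.mem_piAntidiag] at hα
      rw [mem_multiIndices]
      rcases hα with h | h
      · exact h.1.trans_le hk
      · exact h.1.trans_le hm
    · rw [pow_mul]; positivity
  · rw [Finset.disjoint_left]
    intro α h1 h2
    exact hkm ((Finset.mem_piAntidiag.1 h1).1.symm.trans (Finset.mem_piAntidiag.1 h2).1)

/-- The integrand is the derivative of `arctan (a y ^ p / b) / (p a b)`. -/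
theorem integrableOn_and_integral_pow_div {a b : ℝ} (ha : 0 < a) (hb : 0 < b) {p : ℕ}
    (hp : 0 < p) :
    IntegrableOn (fun y : ℝ => y ^ (p - 1) / (a ^ 2 * y ^ (2 * p) + b ^ 2)) (Set.Ioi 0) ∧
    ∫ y in Set.Ioi (0 : ℝ), y ^ (p - 1) / (a ^ 2 * y ^ (2 * p) + b ^ 2)
      = Real.pi / (2 * p * (a * b)) := by
  have hp' : (0 : ℝ) < p := by exact_mod_cast hp
  set F : ℝ → ℝ := fun y => Real.arctan (a / b * y ^ p) / (p * (a * b))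
  have hF : ∀ y ∈ Set.Ici (0 : ℝ),
      HasDerivAt F (y ^ (p - 1) / (a ^ 2 * y ^ (2 * p) + b ^ 2)) y := by
    intro y hy
    have h := (((hasDerivAt_pow p y).const_mul (a / b)).arctan).div_const ((p : ℝ) * (a * b))
    refine h.congr_deriv ?_
    have hy' : (0 : ℝ) ≤ y := hy
    have h1 : a ^ 2 * y ^ (2 * p) + b ^ 2 ≠ 0 := by positivity
    have h2 : 1 + (a / b * y ^ p) ^ 2 ≠ 0 := by positivity
    rw [pow_mul'] at h1 ⊢
    field_simp
    ring
  have hpos : ∀ y ∈ Set.Ioi (0 : ℝ), 0 ≤ y ^ (p - 1) / (a ^ 2 * y ^ (2 * p) + b ^ 2) := by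
    intro y hy
    have hy' : (0 : ℝ) < y := hy
    positivity
  have hlim : Filter.Tendsto F Filter.atTop (nhds (Real.pi / 2 / (p * (a * b)))) := by
    refine Filter.Tendsto.div_const ?_ _
    refine (Real.tendsto_arctan_atTop.mono_right nhdsWithin_le_nhds).comp ?_
    exact (Filter.tendsto_pow_atTop hp.ne').const_mul_atTop (by positivity)
  refine ⟨integrableOn_Ioi_deriv_of_nonneg' hF hpos hlim, ?_⟩
  rw [integral_Ioi_of_hasDerivAt_of_nonneg' hF hpos hlim]
  simp only [F, zero_pow hp.ne', mul_zero, Real.arctan_zero, zero_div, sub_zero]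
  field_simp

/-- The ratio of two consecutive quotients of the left side by `Γ(j + 3/2) ^ 2` is
`(j + 1) (j + 2) / (j + 3/2) ^ 2 < 1`, so the first quotient `4 / π` is the largest. -/
theorem factorial_sq_mul_le_Gamma_sq (j : ℕ) :
    (j.factorial : ℝ) ^ 2 * (j + 1) ≤ 2 * Real.Gamma (j + 3 / 2) ^ 2 := by
  induction j with
  | zero =>
    have h : Real.Gamma ((0 : ℕ) + 3 / 2) = 1 / 2 * √Real.pi := by
      rw [← Real.Gamma_one_half_eq, ← Real.Gamma_add_one (by norm_num)]
      norm_num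
    rw [h, mul_pow, Real.sq_sqrt Real.pi_pos.le]
    have := Real.pi_gt_three
    norm_num
    linarith
  | succ j ih =>
    have h : Real.Gamma (((j + 1 : ℕ) : ℝ) + 3 / 2)
        = (j + 3 / 2) * Real.Gamma (j + 3 / 2) := by
      rw [← Real.Gamma_add_one (by positivity)]
      push_cast
      ring_nf
    rw [h, Nat.factorial_succ]
    push_cast
    have h2 : ((j : ℝ) + 1) * (j + 2) ≤ (j + 3 / 2) ^ 2 := by nlinarith
    calc (((j : ℝ) + 1) * j.factorial) ^ 2 * (j + 1 + 1)
        = ((j : ℝ) + 1) * (j + 2) * ((j.factorial : ℝ) ^ 2 * (j + 1)) := by ring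
      _ ≤ (j + 3 / 2) ^ 2 * (2 * Real.Gamma (j + 3 / 2) ^ 2) := by gcongr
      _ = _ := by ring

/-- The degrees `k = m + p` and `m` add up to `d`, with `k` the least integer larger than `d / 2`;
thus `p = 1` for odd `d` and `p = 2` for even `d`. The quantity that is bounded is what is left of
the integral of the inverse symbol once the powers of `π` are split off. -/
theorem exists_degrees {d : ℕ} (hd : 1 ≤ d) :
    ∃ m p : ℕ, 0 < p ∧ 2 * m + p = d ∧ m + p = d / 2 + 1 ∧
      d / Real.Gamma (d / 2 + 1) * √((m + p).factorial * m.factorial) / p ≤ 2 * (d + 1) := by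
  rcases Nat.even_or_odd' d with ⟨j, rfl | rfl⟩
  · obtain ⟨i, rfl⟩ : ∃ i, j = i + 1 := ⟨j - 1, by omega⟩
    refine ⟨i, 2, by norm_num, by ring, by omega, ?_⟩
    have h : ((2 * (i + 1) : ℕ) : ℝ) / 2 + 1 = ((i + 1 : ℕ) : ℝ) + 1 := by push_cast; ring
    rw [h, Real.Gamma_nat_eq_factorial]
    have h2 : √(((i + 2).factorial : ℝ) * i.factorial) ≤ (i + 2) * i.factorial := by
      rw [Real.sqrt_le_left (by positivity)]
      rw [Nat.factorial_succ, Nat.factorial_succ]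
      push_cast
      have : (0 : ℝ) ≤ (i.factorial : ℝ) ^ 2 * (i + 2) := by positivity
      nlinarith
    calc _ ≤ ((2 * (i + 1) : ℕ) : ℝ) / (i + 1).factorial * ((i + 2) * i.factorial) / (2 : ℕ) := by
          gcongr
      _ = i + 2 := by
          rw [Nat.factorial_succ]
          push_cast
          field_simp
      _ ≤ _ := by push_cast; linarith [(Nat.cast_nonneg i : (0 : ℝ) ≤ i)]
  · refine ⟨j, 1, by norm_num, by ring, by omega, ?_⟩
    have h : ((2 * j + 1 : ℕ) : ℝ) / 2 + 1 = j + 3 / 2 := by push_cast; ring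
    rw [h]
    have hG : 0 < Real.Gamma ((j : ℝ) + 3 / 2) := Real.Gamma_pos_of_pos (by positivity)
    have h2 : √(((j + 1).factorial : ℝ) * j.factorial) ≤ 2 * Real.Gamma ((j : ℝ) + 3 / 2) := by
      rw [Real.sqrt_le_left (by positivity), Nat.factorial_succ]
      have := factorial_sq_mul_le_Gamma_sq j
      push_cast
      nlinarith
    calc _ ≤ ((2 * j + 1 : ℕ) : ℝ) / Real.Gamma ((j : ℝ) + 3 / 2)
          * (2 * Real.Gamma ((j : ℝ) + 3 / 2)) / (1 : ℕ) := by gcongr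
      _ = 2 * (2 * j + 1 : ℕ) := by push_cast; field_simp
      _ ≤ _ := by linarith

/-- The base `√π / (2 π) ≈ 0.2821` is smaller than `(6 / 11) ^ 2 ≈ 0.2975` by a factor below
`19 / 20`, which absorbs the linear factor `d + 1`. -/
theorem pi_mul_pow_le (d : ℕ) :
    Real.pi * (d + 1) * (√Real.pi / (2 * Real.pi)) ^ d ≤ 100.6009 * (6 / 11 : ℝ) ^ (2 * d) := by
  have hs : (1.7691 : ℝ) ≤ √Real.pi :=
    Real.le_sqrt_of_sq_le (by linarith [Real.pi_gt_d2])
  have h1 : √Real.pi / (2 * Real.pi) ≤ 19 / 20 * (6 / 11) ^ 2 := by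
    rw [div_le_iff₀ (by positivity)]
    nth_rw 2 [← Real.mul_self_sqrt Real.pi_pos.le]
    nlinarith
  -- Bernoulli: `(20 / 19) ^ d ≥ 1 + d / 19`
  have h2 : (d + 1 : ℝ) * (19 / 20) ^ d ≤ 19 := by
    have hb := one_add_mul_le_pow (a := (1 / 19 : ℝ)) (by norm_num) d
    have h3 : (19 / 20 : ℝ) ^ d * (1 + 1 / 19) ^ d = 1 := by
      rw [← mul_pow]; norm_num
    have h4 : (0 : ℝ) < (19 / 20 : ℝ) ^ d := by positivity
    nlinarith [mul_le_mul_of_nonneg_left hb h4.le]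
  calc Real.pi * (d + 1) * (√Real.pi / (2 * Real.pi)) ^ d
      ≤ Real.pi * (d + 1) * (19 / 20 * (6 / 11) ^ 2) ^ d := by gcongr
    _ = Real.pi * ((d + 1 : ℝ) * (19 / 20) ^ d) * (6 / 11 : ℝ) ^ (2 * d) := by
        rw [mul_pow, pow_mul]; ring
    _ ≤ 4 * 19 * (6 / 11 : ℝ) ^ (2 * d) := by
        gcongr
        exact Real.pi_le_four
    _ ≤ _ := by gcongr; norm_num

/-- The integral is the value of the reproducing kernel on the diagonal. With the two degrees of
`exists_degrees` the radial integrand is exactly `y ^ (p - 1) / (a ^ 2 * y ^ (2 * p) + b ^ 2)`. -/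
theorem integrable_inv_sobolevSymbol_and_integral_le {d s : ℕ} (hd : 1 ≤ d)
    (hs : (d : ℝ) / 2 < s) :
    Integrable (fun u : Rd d => (sobolevSymbol s u)⁻¹) ∧
    ∫ u : Rd d, (sobolevSymbol s u)⁻¹ ≤ 100.6009 * (6 / 11 : ℝ) ^ (2 * d) := by
  obtain ⟨m, p, hp, hmp, hmp', hbound⟩ := exists_degrees hd
  have hs' : m + p ≤ s := by
    have : (d : ℝ) < 2 * s := by linarith
    have : d < 2 * s := by exact_mod_cast this
    omega
  have : Nonempty (Fin d) := ⟨⟨0, hd⟩⟩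
  set a : ℝ := (2 * Real.pi) ^ (m + p) / √(m + p).factorial
  set b : ℝ := (2 * Real.pi) ^ m / √m.factorial
  have ha : 0 < a := by positivity
  have hb : 0 < b := by positivity
  set g : ℝ → ℝ := fun r => ((2 * Real.pi * r) ^ (2 * (m + p)) / (m + p).factorial
    + (2 * Real.pi * r) ^ (2 * m) / m.factorial)⁻¹
  have hdim : Module.finrank ℝ (Rd d) = d := by simp
  have hg : Set.EqOn (fun y : ℝ => y ^ (d - 1) • g y)
      (fun y : ℝ => y ^ (p - 1) / (a ^ 2 * y ^ (2 * p) + b ^ 2)) (Set.Ioi 0) := by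
    intro y hy
    have hy' : (0 : ℝ) < y := hy
    have e1 : d - 1 = (p - 1) + 2 * m := by omega
    simp only [g, a, b, smul_eq_mul, div_pow, Real.sq_sqrt (Nat.cast_nonneg _)]
    rw [e1, ← div_eq_mul_inv, div_eq_div_iff (by positivity) (by positivity)]
    ring
  obtain ⟨hI, hV⟩ := integrableOn_and_integral_pow_div ha hb hp
  have hgI : Integrable (fun u : Rd d => g ‖u‖) := by
    rw [integrable_fun_norm_addHaar, hdim, integrableOn_congr_fun hg measurableSet_Ioi]
    exact hI
  -- at `u = 0` the right side is the junk value `0⁻¹ = 0` when `m ≠ 0`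
  have hle : ∀ᵐ u : Rd d, (sobolevSymbol s u)⁻¹ ≤ g ‖u‖ := by
    filter_upwards [Measure.ae_ne volume (0 : Rd d)] with u hu
    have : 0 < ‖u‖ := norm_pos_iff.2 hu
    refine inv_anti₀ (by positivity) ?_
    exact norm_pow_add_norm_pow_le_sobolevSymbol hs' (by omega) (by omega) u
  have hpos : ∀ u : Rd d, 0 < sobolevSymbol s u := sobolevSymbol_pos s
  have hint : Integrable (fun u : Rd d => (sobolevSymbol s u)⁻¹) := by
    refine hgI.mono' ?_ ?_
    · exact ((continuous_sobolevSymbol s).inv₀ fun u => (hpos u).ne').aestronglyMeasurable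
    · filter_upwards [hle] with u hu
      rwa [Real.norm_of_nonneg (inv_nonneg.2 (hpos u).le)]
  refine ⟨hint, (integral_mono_ae hint hgI hle).trans ?_⟩
  rw [integral_fun_norm_addHaar, hdim, setIntegral_congr_fun measurableSet_Ioi hg, hV,
    measureReal_def, EuclideanSpace.volume_ball]
  have hG : 0 < Real.Gamma ((d : ℝ) / 2 + 1) := Real.Gamma_pos_of_pos (by positivity)
  simp only [Fintype.card_fin, ENNReal.ofReal_one, one_pow, one_mul, nsmul_eq_mul, smul_eq_mul]
  rw [ENNReal.toReal_ofReal (by positivity)]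
  have hab : a * b = (2 * Real.pi) ^ d / √((m + p).factorial * m.factorial) := by
    simp only [a, b]
    rw [div_mul_div_comm, ← pow_add, Real.sqrt_mul (Nat.cast_nonneg _),
      show m + p + m = d by omega]
  have hp' : (0 : ℝ) < p := by exact_mod_cast hp
  calc _ = Real.pi / 2 * (√Real.pi / (2 * Real.pi)) ^ d
        * (d / Real.Gamma (d / 2 + 1) * √((m + p).factorial * m.factorial) / p) := by
        rw [hab, div_pow]
        field_simp
    _ ≤ Real.pi / 2 * (√Real.pi / (2 * Real.pi)) ^ d * (2 * (d + 1)) := by gcongr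
    _ = Real.pi * (d + 1) * (√Real.pi / (2 * Real.pi)) ^ d := by ring
    _ ≤ _ := pi_mul_pow_le d

/-! ### Quadrature points in a Hilbert space -/

/-- Greedy choice of quadrature points in a Hilbert space: a point whose contribution is not worse
than the average increases the squared distance to the mean by at most `K`. -/
theorem exists_norm_sum_sub_integral_sq_le {X H : Type*} [MeasurableSpace X]
    [NormedAddCommGroup H] [InnerProductSpace ℂ H] [CompleteSpace H] {μ : Measure X}
    [IsProbabilityMeasure μ] {e : X → H} {K : ℝ} (he : Integrable e μ)
    (hK : ∀ x, ‖e x‖ ^ 2 ≤ K) (n : ℕ) :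
    ∃ x : Fin n → X, ‖∑ j, (e (x j) - ∫ y, e y ∂μ)‖ ^ 2 ≤ n * K := by
  set m := ∫ y, e y ∂μ
  induction n with
  | zero => exact ⟨Fin.elim0, by simp⟩
  | succ n ih =>
    obtain ⟨x, hx⟩ := ih
    set S := ∑ j, (e (x j) - m)
    have hin : Integrable (fun y => (inner ℂ (S - m) (e y)).re) μ :=
      (he.const_inner (𝕜 := ℂ) (S - m)).re
    have hval : ∫ y, (inner ℂ (S - m) (e y)).re ∂μ = (inner ℂ (S - m) m).re := by
      rw [← integral_inner he (S - m)]
      exact integral_re (he.const_inner (𝕜 := ℂ) (S - m))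
    -- a cross term at most its mean makes the new square at most `‖S‖ ^ 2 - ‖m‖ ^ 2 + K`
    obtain ⟨y, hy⟩ := exists_le_integral hin
    rw [hval] at hy
    refine ⟨Fin.snoc x y, ?_⟩
    rw [Fin.sum_univ_castSucc]
    simp only [Fin.snoc_castSucc, Fin.snoc_last]
    have h1 : ‖S + (e y - m)‖ ^ 2
        = ‖S - m‖ ^ 2 + 2 * (inner ℂ (S - m) (e y)).re + ‖e y‖ ^ 2 := by
      rw [show S + (e y - m) = (S - m) + e y by abel]
      exact norm_add_sq (𝕜 := ℂ) (S - m) (e y)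
    have h2 : ‖S‖ ^ 2 = ‖S - m‖ ^ 2 + 2 * (inner ℂ (S - m) m).re + ‖m‖ ^ 2 := by
      conv_lhs => rw [show S = (S - m) + m by abel]
      exact norm_add_sq (𝕜 := ℂ) (S - m) m
    have h3 := hK y
    rw [h1]
    push_cast
    nlinarith [sq_nonneg ‖m‖]

/-! ### First order weak derivatives tested against Schwartz functions -/

theorem contDiff_partialDeriv {d : ℕ} (i : Fin d) {φ : Rd d → ℂ} (hφ : ContDiff ℝ ∞ φ) :
    ContDiff ℝ ∞ (partialDeriv i φ) := by
  have h : partialDeriv i φ = fun x => fderiv ℝ φ x (EuclideanSpace.single i 1) := by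
    ext x
    exact ((hφ.differentiable (by simp)) x).lineDeriv_eq_fderiv
  rw [h]
  exact (hφ.fderiv_right (m := ∞) (by simp)).clm_apply contDiff_const

theorem hasCompactSupport_partialDeriv {d : ℕ} (i : Fin d) {φ : Rd d → ℂ}
    (hφ : ContDiff ℝ ∞ φ) (hs : HasCompactSupport φ) :
    HasCompactSupport (partialDeriv i φ) := by
  have h : partialDeriv i φ = fun x => fderiv ℝ φ x (EuclideanSpace.single i 1) := by
    ext x
    exact ((hφ.differentiable (by simp)) x).lineDeriv_eq_fderiv
  rw [h]
  exact hs.fderiv_apply ℝ _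

/-- Raising the last nonzero entry of a multi-index differentiates the test function first, so that
no interchange of derivatives is involved. -/
theorem multiDeriv_update_succ {d : ℕ} (α : Fin d → ℕ) (i : Fin d) (hα : ∀ j, i < j → α j = 0)
    (φ : Rd d → ℂ) :
    multiDeriv (Function.update α i (α i + 1)) φ = multiDeriv α (partialDeriv i φ) := by
  obtain ⟨l₁, l₂, hl⟩ := List.append_of_mem (List.mem_finRange i)
  have hsort := List.pairwise_lt_finRange d
  rw [hl, List.pairwise_append, List.pairwise_cons] at hsort
  obtain ⟨-, ⟨h2, -⟩, h1⟩ := hsort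
  have hlast : ∀ (β : Fin d → ℕ) (ψ : Rd d → ℂ) (l : List (Fin d)), (∀ j ∈ l, β j = 0) →
      l.foldr (fun i ψ => (partialDeriv i)^[β i] ψ) ψ = ψ := by
    intro β ψ l
    induction l with
    | nil => intro _; rfl
    | cons a l ih =>
      intro h
      rw [List.foldr_cons, ih fun j hj => h j (List.mem_cons_of_mem _ hj),
        h a List.mem_cons_self]
      rfl
  have hfirst : ∀ (ψ : Rd d → ℂ) (l : List (Fin d)), (∀ j ∈ l, j ≠ i) →
      l.foldr (fun j ψ => (partialDeriv j)^[Function.update α i (α i + 1) j] ψ) ψ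
        = l.foldr (fun j ψ => (partialDeriv j)^[α j] ψ) ψ := by
    intro ψ l
    induction l with
    | nil => intro _; rfl
    | cons a l ih =>
      intro h
      rw [List.foldr_cons, List.foldr_cons, ih fun j hj => h j (List.mem_cons_of_mem _ hj),
        Function.update_of_ne (h a List.mem_cons_self)]
  unfold multiDeriv
  rw [hl, List.foldr_append, List.foldr_append, List.foldr_cons, List.foldr_cons,
    hfirst _ _ fun j hj => (h1 j hj i List.mem_cons_self).ne,
    hlast α _ _ fun j hj => hα j (h2 j hj),
    hlast (Function.update α i (α i + 1)) _ _ fun j hj => by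
      rw [Function.update_of_ne (h2 j hj).ne', hα j (h2 j hj)],
    Function.update_self, Function.iterate_succ_apply]

theorem multiDeriv_zero {d : ℕ} (φ : Rd d → ℂ) : multiDeriv 0 φ = φ := by
  unfold multiDeriv
  induction List.finRange d with
  | nil => rfl
  | cons a l ih => rw [List.foldr_cons, ih]; rfl

/-- Consecutive weak derivatives of `f` are related by a first order integration by parts. -/
theorem IsWeakDeriv.integral_mul_partialDeriv {d : ℕ} {α : Fin d → ℕ} {i : Fin d}
    {f g h : Rd d → ℂ} (hα : ∀ j, i < j → α j = 0) (hg : IsWeakDeriv α f g)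
    (hh : IsWeakDeriv (Function.update α i (α i + 1)) f h) {φ : Rd d → ℂ}
    (hφ : ContDiff ℝ ∞ φ) (hs : HasCompactSupport φ) :
    ∫ x, g x * partialDeriv i φ x = -∫ x, h x * φ x := by
  have h1 := hg _ (contDiff_partialDeriv i hφ) (hasCompactSupport_partialDeriv i hφ hs)
  have h2 := hh φ hφ hs
  have hsum : ∑ j, Function.update α i (α i + 1) j = ∑ j, α j + 1 := by
    rw [Finset.sum_update_of_mem (Finset.mem_univ i),
      ← Finset.add_sum_erase Finset.univ α (Finset.mem_univ i), Finset.sdiff_singleton_eq_erase]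
    ring
  rw [multiDeriv_update_succ α i hα, h1, hsum, pow_succ, mul_assoc] at h2
  have := mul_left_cancel₀ (pow_ne_zero _ (by norm_num)) h2
  rw [this]
  ring


/-- A first order weak derivative in `L_2` may be tested against Schwartz functions: these are
limits of their products with the dilates of a fixed cutoff function. -/
theorem integral_mul_lineDeriv_schwartz {d : ℕ} {i : Fin d} {g h : Rd d → ℂ}
    (hg : MemLp g 2) (hh : MemLp h 2)
    (H : ∀ φ : Rd d → ℂ, ContDiff ℝ ∞ φ → HasCompactSupport φ →
      ∫ x, g x * partialDeriv i φ x = -∫ x, h x * φ x) (ψ : 𝓢(Rd d, ℂ)) :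
    ∫ x, g x * (∂_{EuclideanSpace.single i (1 : ℝ)} ψ) x = -∫ x, h x * ψ x := by
  set b : ContDiffBump (0 : Rd d) := ⟨1, 2, one_pos, one_lt_two⟩
  set χ : Rd d → ℂ := fun x => ((b x : ℝ) : ℂ)
  have hχ : ContDiff ℝ ∞ χ := Complex.ofRealCLM.contDiff.comp b.contDiff
  have hχs : HasCompactSupport χ := b.hasCompactSupport.comp_left (g := ((↑) : ℝ → ℂ)) rfl
  have hχ1 : ∀ x, ‖χ x‖ ≤ 1 := fun x => by
    simpa [χ, abs_of_nonneg b.nonneg] using b.le_one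
  obtain ⟨C, hC⟩ := (hasCompactSupport_partialDeriv i hχ hχs).exists_bound_of_continuous
    (contDiff_partialDeriv i hχ).continuous
  set c : ℕ → ℝ := fun n => 1 / ((n : ℝ) + 1)
  have hc0 : ∀ n, 0 < c n := fun n => by positivity
  have hc1 : ∀ n, c n ≤ 1 := fun n => by
    rw [div_le_one (by positivity)]; linarith [(Nat.cast_nonneg n : (0 : ℝ) ≤ n)]
  have hc : Filter.Tendsto c Filter.atTop (nhds 0) := tendsto_one_div_add_atTop_nhds_zero_nat
  set φ : ℕ → Rd d → ℂ := fun n x => χ (c n • x) * ψ x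
  have hcd : ∀ n, ContDiff ℝ ∞ fun x : Rd d => χ (c n • x) := fun n =>
    hχ.comp (contDiff_const_smul _)
  have hφ : ∀ n, ContDiff ℝ ∞ (φ n) := fun n => (hcd n).mul (ψ.smooth ⊤)
  have hφs : ∀ n, HasCompactSupport (φ n) := fun n =>
    (hχs.comp_smul (hc0 n).ne').mul_right
  set v : Rd d := EuclideanSpace.single i (1 : ℝ)
  have hpd : ∀ n x, partialDeriv i (φ n) x
      = χ (c n • x) * (∂_{v} ψ) x + c n * partialDeriv i χ (c n • x) * ψ x := by
    intro n x
    have d1 : DifferentiableAt ℝ (fun x : Rd d => χ (c n • x)) x :=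
      (hcd n).differentiable (by simp) x
    have d2 : DifferentiableAt ℝ (ψ : Rd d → ℂ) x := ψ.differentiableAt
    have d3 : DifferentiableAt ℝ χ (c n • x) := hχ.differentiable (by simp) _
    have e : φ n = (fun x : Rd d => χ (c n • x)) * (ψ : Rd d → ℂ) := rfl
    rw [partialDeriv, e, (d1.mul d2).lineDeriv_eq_fderiv, partialDeriv, d3.lineDeriv_eq_fderiv,
      SchwartzMap.lineDerivOp_apply_eq_fderiv, fderiv_mul d1 d2, fderiv_comp_smul]
    simp
    ring
  have lim1 : ∀ x, Filter.Tendsto (fun n => χ (c n • x)) Filter.atTop (nhds 1) := by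
    intro x
    have h0 : Filter.Tendsto (fun n => c n • x) Filter.atTop (nhds 0) := by
      simpa using hc.smul_const x
    have : χ 0 = 1 := by
      have : b 0 = 1 := b.one_of_mem_closedBall (by simp [b])
      simp [χ, this]
    rw [← this]
    exact (hχ.continuous.tendsto 0).comp h0
  have lim2 : ∀ x, Filter.Tendsto (fun n => (c n : ℂ) * partialDeriv i χ (c n • x))
      Filter.atTop (nhds 0) := by
    intro x
    refine squeeze_zero_norm (a := fun n => c n * C) (fun n => ?_) (by simpa using hc.mul_const C)
    rw [norm_mul, Complex.norm_real, Real.norm_of_nonneg (hc0 n).le]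
    exact mul_le_mul_of_nonneg_left (hC _) (hc0 n).le
  have hψ2 : MemLp ψ 2 (volume : Measure (Rd d)) := ψ.memLp 2
  have hψ2' : MemLp (∂_{v} ψ : 𝓢(Rd d, ℂ)) 2 (volume : Measure (Rd d)) := (∂_{v} ψ).memLp 2
  have i1 : Integrable (fun x => ‖g x‖ * ‖(∂_{v} ψ) x‖) := hg.norm.integrable_mul hψ2'.norm
  have i2 : Integrable (fun x => ‖g x‖ * ‖ψ x‖) := hg.norm.integrable_mul hψ2.norm
  have i3 : Integrable (fun x => ‖h x‖ * ‖ψ x‖) := hh.norm.integrable_mul hψ2.norm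
  have L1 : Filter.Tendsto (fun n => ∫ x, g x * partialDeriv i (φ n) x) Filter.atTop
      (nhds (∫ x, g x * (∂_{v} ψ) x)) := by
    refine tendsto_integral_of_dominated_convergence
      (fun x => ‖g x‖ * ‖(∂_{v} ψ) x‖ + C * (‖g x‖ * ‖ψ x‖)) (fun n => ?_)
      (i1.add (i2.const_mul C)) (fun n => .of_forall fun x => ?_) (.of_forall fun x => ?_)
    · exact hg.1.mul (contDiff_partialDeriv i (hφ n)).continuous.aestronglyMeasurable
    · rw [norm_mul, hpd]
      have e1 : ‖χ (c n • x) * (∂_{v} ψ) x‖ ≤ ‖(∂_{v} ψ) x‖ := by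
        rw [norm_mul]
        exact mul_le_of_le_one_left (norm_nonneg _) (hχ1 _)
      have e2 : ‖(c n : ℂ) * partialDeriv i χ (c n • x) * ψ x‖ ≤ C * ‖ψ x‖ := by
        rw [norm_mul, norm_mul, Complex.norm_real, Real.norm_of_nonneg (hc0 n).le]
        refine mul_le_mul_of_nonneg_right ?_ (norm_nonneg _)
        calc c n * ‖partialDeriv i χ (c n • x)‖ ≤ 1 * C :=
              mul_le_mul (hc1 n) (hC _) (norm_nonneg _) zero_le_one
          _ = C := one_mul C
      calc _ ≤ ‖g x‖ * (‖(∂_{v} ψ) x‖ + C * ‖ψ x‖) :=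
            mul_le_mul_of_nonneg_left ((norm_add_le _ _).trans (add_le_add e1 e2)) (norm_nonneg _)
        _ = _ := by ring
    · simp only [hpd]
      have := ((lim1 x).mul_const ((∂_{v} ψ) x)).add ((lim2 x).mul_const (ψ x))
      simpa using this.const_mul (g x)
  have L2 : Filter.Tendsto (fun n => ∫ x, h x * φ n x) Filter.atTop
      (nhds (∫ x, h x * ψ x)) := by
    refine tendsto_integral_of_dominated_convergence
      (fun x => ‖h x‖ * ‖ψ x‖) (fun n => ?_)
      i3 (fun n => .of_forall fun x => ?_) (.of_forall fun x => ?_)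
    · exact hh.1.mul (hφ n).continuous.aestronglyMeasurable
    · rw [norm_mul, norm_mul]
      exact mul_le_mul_of_nonneg_left (mul_le_of_le_one_left (norm_nonneg _) (hχ1 _))
        (norm_nonneg _)
    · have := ((lim1 x).mul_const (ψ x)).const_mul (h x)
      simpa using this
  refine tendsto_nhds_unique L1 ?_
  simp only [fun n => H (φ n) (hφ n) (hφs n)]
  exact L2.neg

/-! ### Fourier transforms of weak derivatives -/

/-- The hypothesis says that `h` is the distributional derivative of `g`, so the rule for the
Fourier transform of a derivative of a tempered distribution applies. -/
theorem fourier_ae_eq_mul_of_integral_lineDeriv {d : ℕ} {i : Fin d}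
    {g h : Lp ℂ 2 (volume : Measure (Rd d))}
    (H : ∀ ψ : 𝓢(Rd d, ℂ),
      ∫ x, g x * (∂_{EuclideanSpace.single i (1 : ℝ)} ψ) x = -∫ x, h x * ψ x) :
    (𝓕 h : Lp ℂ 2 (volume : Measure (Rd d))) =ᵐ[volume]
      fun u => 2 * Real.pi * Complex.I * u i
        * (𝓕 g : Lp ℂ 2 (volume : Measure (Rd d))) u := by
  set v : Rd d := EuclideanSpace.single i (1 : ℝ)
  have hD : ∂_{v} (g : 𝓢'(Rd d, ℂ)) = (h : 𝓢'(Rd d, ℂ)) := by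
    ext ψ
    rw [TemperedDistribution.lineDerivOp_apply_apply, Lp.toTemperedDistribution_apply,
      Lp.toTemperedDistribution_apply]
    have := H ψ
    simp only [smul_eq_mul, neg_apply, neg_mul, integral_neg]
    simp only [mul_comm _ (g _), mul_comm _ (h _)]
    rw [this, neg_neg]
  have hF := congrArg (fun T : 𝓢'(Rd d, ℂ) => 𝓕 T) hD
  simp only [TemperedDistribution.fourier_lineDerivOp_eq,
    Lp.fourier_toTemperedDistribution_eq] at hF
  have htemp : (fun u : Rd d => ((inner ℝ u v : ℝ) : ℂ)).HasTemperateGrowth := by fun_prop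
  have hv : ∀ u : Rd d, (inner ℝ u v : ℝ) = u i := fun u => by
    simp [v, EuclideanSpace.inner_single_right]
  simp only [hv] at hF htemp
  set G := (𝓕 g : Lp ℂ 2 (volume : Measure (Rd d)))
  have hG : LocallyIntegrable G volume := (Lp.memLp G).locallyIntegrable (by norm_num)
  refine ae_eq_of_integral_contDiff_smul_eq
    ((Lp.memLp (𝓕 h)).locallyIntegrable (by norm_num)) ?_ ?_
  · rw [locallyIntegrable_iff]
    intro K hK
    exact (hG.integrableOn_isCompact hK).continuousOn_mul (by fun_prop) hK
  · intro χ hχ hχs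
    have hs : HasCompactSupport (Complex.ofRealCLM ∘ χ) := hχs.comp_left rfl
    have hc : ContDiff ℝ ∞ (Complex.ofRealCLM ∘ χ) := by fun_prop
    have key := congrArg (fun T : 𝓢'(Rd d, ℂ) => T (hs.toSchwartzMap hc)) hF
    simp only [Lp.toTemperedDistribution_apply, smul_apply,
      TemperedDistribution.smulLeftCLM_apply_apply, SchwartzMap.smulLeftCLM_apply_apply htemp,
      HasCompactSupport.toSchwartzMap_toFun, Function.comp_apply, Complex.ofRealCLM_apply,
      smul_eq_mul, ← integral_const_mul] at key
    simp only [Complex.real_smul]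
    rw [← key]
    congr 1 with u
    ring

/-- The Fourier transform turns an `L_2` weak derivative of order at most `s` into multiplication by
a monomial, by induction on the order of the derivative. -/
theorem fourier_weakDeriv_ae_eq {d s : ℕ} {f : Rd d → ℂ}
    (hf : ∀ α ∈ multiIndices d s, HasL2WeakDeriv α f) {g₀ : Rd d → ℂ} (hg₀ : MemLp g₀ 2)
    (hfg : f =ᵐ[volume] g₀) (N : ℕ) :
    ∀ (α : Fin d → ℕ) (g : Rd d → ℂ) (hg : MemLp g 2), ∑ j, α j = N → N ≤ s →
      IsWeakDeriv α f g →
      (𝓕 hg.toLp : Lp ℂ 2 (volume : Measure (Rd d))) =ᵐ[volume]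
        fun u => (∏ j, (2 * Real.pi * Complex.I * u j) ^ α j)
          * (𝓕 hg₀.toLp : Lp ℂ 2 (volume : Measure (Rd d))) u := by
  induction N with
  | zero =>
    intro α g hg hα _ hfg'
    have hα0 : α = 0 := by
      ext j
      exact (Finset.sum_eq_zero_iff.1 hα) j (Finset.mem_univ j)
    subst hα0
    have h : g₀ =ᵐ[volume] g := by
      refine ae_eq_of_integral_contDiff_smul_eq (hg₀.locallyIntegrable (by norm_num))
        (hg.locallyIntegrable (by norm_num)) fun χ hχ hχs => ?_
      have := hfg' (Complex.ofRealCLM ∘ χ) (by fun_prop) (hχs.comp_left rfl)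
      simp only [multiDeriv_zero, hα, pow_zero, one_mul, Function.comp_apply,
        Complex.ofRealCLM_apply] at this
      simp only [Complex.real_smul, mul_comm ((χ _ : ℝ) : ℂ)]
      rw [← this]
      refine integral_congr_ae ?_
      filter_upwards [hfg] with x hx
      rw [hx]
    have : hg.toLp = hg₀.toLp := (MemLp.toLp_eq_toLp_iff hg hg₀).2 h.symm
    rw [this]
    exact .of_forall fun u => by simp
  | succ N ih =>
    intro α g hg hα hN hfg'
    -- the last index with a nonzero entry
    obtain ⟨i, hi, hmax⟩ : ∃ i, α i ≠ 0 ∧ ∀ j, i < j → α j = 0 := by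
      have hne : (Finset.univ.filter fun j => α j ≠ 0).Nonempty := by
        by_contra hcon
        rw [Finset.not_nonempty_iff_eq_empty, Finset.filter_eq_empty_iff] at hcon
        have : ∑ j, α j = 0 := Finset.sum_eq_zero fun j hj => not_not.1 (hcon hj)
        omega
      obtain ⟨i, hi, hmax⟩ := Finset.exists_max_image _ id hne
      refine ⟨i, (Finset.mem_filter.1 hi).2, fun j hj => ?_⟩
      by_contra hcon
      exact absurd (hmax j (Finset.mem_filter.2 ⟨Finset.mem_univ j, hcon⟩)) (not_le.2 hj)
    set β : Fin d → ℕ := Function.update α i (α i - 1)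
    have hβi : β i + 1 = α i := by simp only [β, Function.update_self]; omega
    have hβ : Function.update β i (β i + 1) = α := by
      rw [hβi]; simp [β]
    have hβj : ∀ j, j ≠ i → β j = α j := fun j hj => Function.update_of_ne hj _ _
    have hβsum : ∑ j, β j = N := by
      have h1 := Finset.add_sum_erase Finset.univ α (Finset.mem_univ i)
      have h2 := Finset.add_sum_erase Finset.univ β (Finset.mem_univ i)
      have h3 : ∑ j ∈ Finset.univ.erase i, β j = ∑ j ∈ Finset.univ.erase i, α j :=
        Finset.sum_congr rfl fun j hj => hβj j (Finset.ne_of_mem_erase hj)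
      omega
    obtain ⟨k, hk, hfk⟩ := hf β (mem_multiIndices.2 (by omega))
    have hstep : (𝓕 hg.toLp : Lp ℂ 2 (volume : Measure (Rd d))) =ᵐ[volume]
        fun u => 2 * Real.pi * Complex.I * u i
          * (𝓕 hk.toLp : Lp ℂ 2 (volume : Measure (Rd d))) u := by
      refine fourier_ae_eq_mul_of_integral_lineDeriv fun ψ => ?_
      have := integral_mul_lineDeriv_schwartz hk hg (fun φ hφ hφs =>
        hfk.integral_mul_partialDeriv (i := i)
          (fun j hj => by rw [hβj j hj.ne', hmax j hj]) (by rwa [hβ]) hφ hφs) ψ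
      have e1 : ∀ (k : Rd d → ℂ) (hk : MemLp k 2 volume) (φ : 𝓢(Rd d, ℂ)),
          ∫ x, hk.toLp k x * φ x = ∫ x, k x * φ x := fun k hk φ => by
        refine integral_congr_ae ?_
        filter_upwards [hk.coeFn_toLp] with x hx
        rw [hx]
      rw [e1, e1]
      exact this
    filter_upwards [hstep, ih β k hk hβsum (by omega) hfk] with u h1 h2
    rw [h1, h2, ← Finset.mul_prod_erase Finset.univ _ (Finset.mem_univ i),
      ← Finset.mul_prod_erase Finset.univ _ (Finset.mem_univ i), ← hβi, pow_succ,
      Finset.prod_congr rfl fun j hj => by rw [hβj j (Finset.ne_of_mem_erase hj)]]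
    ring

/-- A continuous square integrable function whose Fourier transform is integrable is given
everywhere by Fourier inversion. -/
theorem eq_fourierInv_of_integrable_fourier {d : ℕ} {f : Rd d → ℂ} (hf : Continuous f)
    {g : Rd d → ℂ} (hg : MemLp g 2) (hfg : f =ᵐ[volume] g)
    (hF : Integrable (𝓕 hg.toLp : Lp ℂ 2 (volume : Measure (Rd d))) volume) :
    f = 𝓕⁻ ((𝓕 hg.toLp : Lp ℂ 2 (volume : Measure (Rd d))) : Rd d → ℂ) := by
  set F := (𝓕 hg.toLp : Lp ℂ 2 (volume : Measure (Rd d)))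
  have hL : Continuous fun p : Rd d × Rd d => (-innerₗ (Rd d)) p.1 p.2 :=
    (continuous_inner (𝕜 := ℝ) (E := Rd d)).neg
  have hcont : Continuous (𝓕⁻ (F : Rd d → ℂ)) :=
    VectorFourier.fourierIntegral_continuous Real.continuous_fourierChar hL hF
  have hT : 𝓕⁻ (F : 𝓢'(Rd d, ℂ)) = (hg.toLp : 𝓢'(Rd d, ℂ)) := by
    rw [Lp.fourierInv_toTemperedDistribution_eq, FourierTransform.fourierInv_fourier_eq]
  refine (hf.ae_eq_iff_eq volume hcont).1 ?_
  refine ae_eq_of_integral_contDiff_smul_eq hf.locallyIntegrable hcont.locallyIntegrable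
    fun χ hχ hχs => ?_
  have hs : HasCompactSupport (Complex.ofRealCLM ∘ χ) := hχs.comp_left rfl
  have hc : ContDiff ℝ ∞ (Complex.ofRealCLM ∘ χ) := by fun_prop
  set ψ := hs.toSchwartzMap hc
  have key := congrArg (fun T : 𝓢'(Rd d, ℂ) => T ψ) hT
  simp only [TemperedDistribution.fourierInv_apply, Lp.toTemperedDistribution_apply] at key
  have hflip : ∫ u, (𝓕⁻ ψ) u • F u = ∫ x, ψ x • (𝓕⁻ (F : Rd d → ℂ)) x := by
    have := VectorFourier.integral_fourierIntegral_smul_eq_flip (L := -innerₗ (Rd d))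
      (μ := volume) (ν := volume) Real.continuous_fourierChar hL
      (ψ.integrable (μ := volume)) hF
    rw [show (-innerₗ (Rd d)).flip = -innerₗ (Rd d) by ext; simp [real_inner_comm]] at this
    rw [SchwartzMap.fourierInv_coe]
    exact this
  rw [hflip] at key
  have e1 : ∫ x, χ x • f x = ∫ x, ψ x • hg.toLp g x := by
    refine integral_congr_ae ?_
    filter_upwards [hfg, hg.coeFn_toLp] with x h1 h2
    rw [h1, h2]
    rfl
  rw [e1, ← key]
  rfl

/-! ### The feature map of the Sobolev space -/

theorem norm_sq_toLp_two {X : Type*} [MeasurableSpace X] {μ : Measure X} {g : X → ℂ}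
    (hg : MemLp g 2 μ) : ‖hg.toLp g‖ ^ 2 = ∫ x, ‖g x‖ ^ 2 ∂μ := by
  have h := inner_self_eq_norm_sq_to_K (𝕜 := ℂ) (hg.toLp g)
  rw [L2.inner_def] at h
  have h2 : ∫ x, inner ℂ (hg.toLp g x) (hg.toLp g x) ∂μ = ((∫ x, ‖g x‖ ^ 2 ∂μ : ℝ) : ℂ) := by
    rw [← integral_complex_ofReal]
    refine integral_congr_ae ?_
    filter_upwards [hg.coeFn_toLp] with x hx
    rw [hx, inner_self_eq_norm_sq_to_K]
    simp
  rw [h2] at h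
  exact (Complex.ofReal_injective (h.trans (by simp))).symm

/-- The function on the frequency side that represents evaluation at `x`: its conjugate pairs with
`√v · 𝓕 f`, where `v` is the symbol, to the Fourier inversion integral of `f` at `x`. -/
noncomputable def evalFrequency {d : ℕ} (s : ℕ) (x u : Rd d) : ℂ :=
  ((√(sobolevSymbol s u))⁻¹ : ℝ) * (𝐞 (-inner ℝ u x) : ℂ)

theorem continuous_evalFrequency {d : ℕ} (s : ℕ) :
    Continuous (Function.uncurry (evalFrequency s : Rd d → Rd d → ℂ)) := by
  have h1 : Continuous fun p : Rd d × Rd d => (√(sobolevSymbol s p.2))⁻¹ :=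
    (((continuous_sobolevSymbol s).comp continuous_snd).sqrt).inv₀ fun p =>
      (Real.sqrt_pos.2 (sobolevSymbol_pos s p.2)).ne'
  have h2 : Continuous fun p : Rd d × Rd d => (𝐞 (-inner ℝ p.2 p.1) : ℂ) :=
    continuous_subtype_val.comp (Real.continuous_fourierChar.comp
      (continuous_snd.inner continuous_fst).neg)
  exact (Complex.continuous_ofReal.comp h1).mul h2

theorem norm_evalFrequency_sq {d : ℕ} (s : ℕ) (x u : Rd d) :
    ‖evalFrequency s x u‖ ^ 2 = (sobolevSymbol s u)⁻¹ := by
  rw [evalFrequency, norm_mul, Circle.norm_coe, mul_one, Complex.norm_real,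
    Real.norm_of_nonneg (by positivity), inv_pow, Real.sq_sqrt (sobolevSymbol_pos s u).le]

theorem memLp_evalFrequency {d s : ℕ}
    (hI : Integrable (fun u : Rd d => (sobolevSymbol s u)⁻¹)) (x : Rd d) :
    MemLp (evalFrequency s x) 2 volume := by
  have hc : Continuous (evalFrequency s x) := (continuous_evalFrequency s).uncurry_left x
  refine (memLp_two_iff_integrable_sq_norm hc.aestronglyMeasurable).2 ?_
  simpa only [norm_evalFrequency_sq] using hI

/-- The feature map of the Sobolev space: `W^s_2` is carried isometrically into `L_2` so that
evaluation at `x` becomes the inner product with `evalFeature hI x`. -/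
noncomputable def evalFeature {d s : ℕ}
    (hI : Integrable (fun u : Rd d => (sobolevSymbol s u)⁻¹)) (x : Rd d) :
    Lp ℂ 2 (volume : Measure (Rd d)) :=
  (memLp_evalFrequency hI x).toLp

theorem norm_evalFeature_sq {d s : ℕ}
    (hI : Integrable (fun u : Rd d => (sobolevSymbol s u)⁻¹)) (x : Rd d) :
    ‖evalFeature hI x‖ ^ 2 = ∫ u : Rd d, (sobolevSymbol s u)⁻¹ := by
  rw [evalFeature, norm_sq_toLp_two]
  simp only [norm_evalFrequency_sq]

theorem continuous_evalFeature {d s : ℕ}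
    (hI : Integrable (fun u : Rd d => (sobolevSymbol s u)⁻¹)) :
    Continuous (evalFeature hI) := by
  have hsec : ∀ x : Rd d, Continuous (evalFrequency s x) := fun x =>
    (continuous_evalFrequency s).uncurry_left x
  refine continuous_iff_continuousAt.2 fun y => ?_
  have hdist : ∀ x, ‖evalFeature hI x - evalFeature hI y‖ ^ 2
      = ∫ u, ‖evalFrequency s x u - evalFrequency s y u‖ ^ 2 := by
    intro x
    have := norm_sq_toLp_two ((memLp_evalFrequency hI x).sub (memLp_evalFrequency hI y))
    rw [MemLp.toLp_sub] at this
    exact this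
  have hc : Continuous fun x => ∫ u, ‖evalFrequency s x u - evalFrequency s y u‖ ^ 2 := by
    refine continuous_of_dominated (bound := fun u => 4 * (sobolevSymbol s u)⁻¹) (fun x => ?_)
      (fun x => .of_forall fun u => ?_) (hI.const_mul 4) (.of_forall fun u => ?_)
    · exact (((hsec x).sub (hsec y)).norm.pow 2).aestronglyMeasurable
    · rw [Real.norm_of_nonneg (by positivity)]
      have h1 := norm_sub_le (evalFrequency s x u) (evalFrequency s y u)
      have h2 := norm_evalFrequency_sq s x u
      have h3 := norm_evalFrequency_sq s y u
      have h4 := norm_nonneg (evalFrequency s x u - evalFrequency s y u)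
      nlinarith [sq_nonneg (‖evalFrequency s x u‖ - ‖evalFrequency s y u‖)]
    · exact (((continuous_evalFrequency s).uncurry_right u).sub continuous_const).norm.pow 2
  rw [ContinuousAt, tendsto_iff_norm_sub_tendsto_zero]
  have h0 := (hc.tendsto y).sqrt
  simp only [← hdist, sub_self, norm_zero, Real.sqrt_sq (norm_nonneg _)] at h0
  simpa using h0

theorem weakDeriv_spec {d : ℕ} {α : Fin d → ℕ} {f : Rd d → ℂ} (h : HasL2WeakDeriv α f) :
    MemLp (weakDeriv α f) 2 volume ∧ IsWeakDeriv α f (weakDeriv α f) := by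
  rw [weakDeriv, dif_pos h]
  exact h.choose_spec

theorem ae_eq_weakDeriv_zero {d : ℕ} {f : Rd d → ℂ} (hf : Continuous f)
    (h : HasL2WeakDeriv 0 f) : f =ᵐ[volume] weakDeriv 0 f := by
  obtain ⟨h1, h2⟩ := weakDeriv_spec h
  refine ae_eq_of_integral_contDiff_smul_eq hf.locallyIntegrable
    (h1.locallyIntegrable (by norm_num)) fun χ hχ hχs => ?_
  have := h2 (Complex.ofRealCLM ∘ χ) (by fun_prop) (hχs.comp_left rfl)
  simp only [multiDeriv_zero, Pi.zero_apply, Finset.sum_const_zero, pow_zero, one_mul,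
    Function.comp_apply, Complex.ofRealCLM_apply] at this
  simpa only [Complex.real_smul, mul_comm ((χ _ : ℝ) : ℂ)] using this

/-- By Plancherel's theorem, `W^s_2` carries the norm of `L_2` with the weight `sobolevSymbol s` on
the frequency side, and point evaluation is the pairing with the feature map. -/
theorem exists_eq_inner_evalFeature {d s : ℕ}
    (hI : Integrable (fun u : Rd d => (sobolevSymbol s u)⁻¹)) {f : Rd d → ℂ}
    (hf : f ∈ sobolevSpace d s) :
    ∃ a : Lp ℂ 2 (volume : Measure (Rd d)), ‖a‖ = sobolevNorm d s f ∧
      ∀ x, f x = inner ℂ (evalFeature hI x) a := by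
  obtain ⟨hcont, hder⟩ := hf
  have h0 := hder 0 (mem_multiIndices.2 (by simp))
  have hg₀ := (weakDeriv_spec h0).1
  have hfg := ae_eq_weakDeriv_zero hcont h0
  set F := (𝓕 hg₀.toLp : Lp ℂ 2 (volume : Measure (Rd d)))
  have hterm : ∀ α ∈ multiIndices d s,
      Integrable (fun u => (∏ j, ((2 * Real.pi * u j) ^ 2) ^ α j) * ‖F u‖ ^ 2) ∧
      ∫ u, ‖weakDeriv α f u‖ ^ 2
        = ∫ u, (∏ j, ((2 * Real.pi * u j) ^ 2) ^ α j) * ‖F u‖ ^ 2 := by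
    intro α hα
    obtain ⟨h1, h2⟩ := weakDeriv_spec (hder α hα)
    have hae := fourier_weakDeriv_ae_eq hder hg₀ hfg _ α _ h1 rfl (mem_multiIndices.1 hα) h2
    have hsq : (fun u => ‖(𝓕 h1.toLp : Lp ℂ 2 (volume : Measure (Rd d))) u‖ ^ 2) =ᵐ[volume]
        fun u => (∏ j, ((2 * Real.pi * u j) ^ 2) ^ α j) * ‖F u‖ ^ 2 := by
      filter_upwards [hae] with u hu
      rw [hu, norm_mul, mul_pow, norm_prod, ← Finset.prod_pow]
      congr 1
      refine Finset.prod_congr rfl fun j _ => ?_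
      rw [norm_pow, ← pow_mul, mul_comm (α j) 2, pow_mul]
      congr 1
      simp [mul_pow, abs_of_pos Real.pi_pos]
    have hL := Lp.memLp (𝓕 h1.toLp : Lp ℂ 2 (volume : Measure (Rd d)))
    refine ⟨((memLp_two_iff_integrable_sq_norm hL.1).1 hL).congr hsq, ?_⟩
    rw [← integral_congr_ae hsq, ← norm_sq_toLp_two h1, ← norm_sq_toLp_two hL,
      Lp.toLp_coeFn, Lp.norm_fourier_eq]
  have hsymb : ∀ u, sobolevSymbol s u * ‖F u‖ ^ 2
      = ∑ α ∈ multiIndices d s, (∏ j, ((2 * Real.pi * u j) ^ 2) ^ α j) * ‖F u‖ ^ 2 := fun u => by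
    rw [sobolevSymbol, Finset.sum_mul]
  have hnorm : (sobolevInner d s f f).re = ∫ u, sobolevSymbol s u * ‖F u‖ ^ 2 := by
    simp only [hsymb]
    rw [integral_finsetSum _ fun α hα => (hterm α hα).1, sobolevInner, Complex.re_sum]
    refine Finset.sum_congr rfl fun α hα => ?_
    rw [← (hterm α hα).2]
    simp only [Complex.mul_conj, Complex.normSq_eq_norm_sq]
    rw [integral_complex_ofReal, Complex.ofReal_re]
  have hint : Integrable fun u => sobolevSymbol s u * ‖F u‖ ^ 2 := by
    simp only [hsymb]
    exact integrable_finsetSum _ fun α hα => (hterm α hα).1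
  have hFm : AEStronglyMeasurable F volume := Lp.aestronglyMeasurable F
  have hsq : Continuous fun u : Rd d => ((√(sobolevSymbol s u) : ℝ) : ℂ) :=
    Complex.continuous_ofReal.comp (continuous_sobolevSymbol s).sqrt
  have hnsq : ∀ u, ‖((√(sobolevSymbol s u) : ℝ) : ℂ) * F u‖ ^ 2
      = sobolevSymbol s u * ‖F u‖ ^ 2 := fun u => by
    rw [norm_mul, mul_pow, Complex.norm_real, Real.norm_of_nonneg (Real.sqrt_nonneg _),
      Real.sq_sqrt (sobolevSymbol_pos s u).le]
  have ha : MemLp (fun u => ((√(sobolevSymbol s u) : ℝ) : ℂ) * F u) 2 volume := by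
    refine (memLp_two_iff_integrable_sq_norm (hsq.aestronglyMeasurable.mul hFm)).2 ?_
    exact hint.congr (.of_forall fun u => (hnsq u).symm)
  have hcancel : ∀ x u, conj (evalFrequency s x u) * (((√(sobolevSymbol s u) : ℝ) : ℂ) * F u)
      = 𝐞 (inner ℝ u x) • F u := fun x u => by
    have hne : ((√(sobolevSymbol s u) : ℝ) : ℂ) ≠ 0 := by
      exact_mod_cast (Real.sqrt_pos.2 (sobolevSymbol_pos s u)).ne'
    have hch : conj ((𝐞 (-inner ℝ u x) : Circle) : ℂ) = (𝐞 (inner ℝ u x) : Circle) := by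
      rw [← Circle.coe_inv_eq_conj, AddChar.map_neg_eq_inv, inv_inv]
    rw [evalFrequency, map_mul, Complex.conj_ofReal, hch, Circle.smul_def, smul_eq_mul]
    push_cast
    field_simp
  have hF1 : Integrable F volume := by
    have h := ((memLp_evalFrequency hI 0).star).integrable_mul ha
    refine h.congr (.of_forall fun u => ?_)
    have := hcancel 0 u
    simpa using this
  refine ⟨ha.toLp, ?_, fun x => ?_⟩
  · rw [sobolevNorm, hnorm, ← Real.sqrt_sq (norm_nonneg (ha.toLp _)), norm_sq_toLp_two]
    simp only [hnsq]
  · have hinv := congrFun (eq_fourierInv_of_integrable_fourier hcont hg₀ hfg hF1) x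
    rw [hinv, Real.fourierInv_eq, L2.inner_def]
    refine integral_congr_ae ?_
    filter_upwards [(memLp_evalFrequency hI x).coeFn_toLp, ha.coeFn_toLp] with u h1 h2
    rw [evalFeature, h1, h2, RCLike.inner_apply, mul_comm]
    exact (hcancel x u).symm

/-! ### Worst case error and information complexity -/

/-- The probability measure with density `ρ`. -/
noncomputable def densityMeasure {d : ℕ} (ρ : Rd d → ℝ) : Measure (Rd d) :=
  volume.withDensity fun x => ENNReal.ofReal (ρ x)

theorem IsProbDensity.isProbabilityMeasure {d : ℕ} {ρ : Rd d → ℝ} (hρ : IsProbDensity ρ) :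
    IsProbabilityMeasure (densityMeasure ρ) := by
  constructor
  rw [densityMeasure, withDensity_apply _ MeasurableSet.univ, Measure.restrict_univ,
    ← ofReal_integral_eq_lintegral_ofReal hρ.integrable (.of_forall hρ.nonneg),
    hρ.integral_eq_one, ENNReal.ofReal_one]

theorem IsProbDensity.weightedIntegral_eq {d : ℕ} {ρ : Rd d → ℝ} (hρ : IsProbDensity ρ)
    (f : Rd d → ℂ) : weightedIntegral ρ f = ∫ x, f x ∂densityMeasure ρ := by
  rw [densityMeasure, integral_withDensity_eq_integral_toReal_smul₀
    hρ.integrable.aemeasurable.ennreal_ofReal (.of_forall fun _ => ENNReal.ofReal_lt_top),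
    weightedIntegral]
  congr 1 with x
  rw [ENNReal.toReal_ofReal (hρ.nonneg x), Complex.real_smul, mul_comm]

theorem norm_evalFeature {d s : ℕ}
    (hI : Integrable (fun u : Rd d => (sobolevSymbol s u)⁻¹)) (x : Rd d) :
    ‖evalFeature hI x‖ = √(∫ u : Rd d, (sobolevSymbol s u)⁻¹) := by
  rw [← norm_evalFeature_sq hI x, Real.sqrt_sq (norm_nonneg _)]

theorem integrable_evalFeature {d s : ℕ}
    (hI : Integrable (fun u : Rd d => (sobolevSymbol s u)⁻¹)) (μ : Measure (Rd d))
    [IsFiniteMeasure μ] : Integrable (evalFeature hI) μ :=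
  .of_bound (continuous_evalFeature hI).aestronglyMeasurable _
    (.of_forall fun x => (norm_evalFeature hI x).le)

theorem integrable_mul_density {d s : ℕ}
    (hI : Integrable (fun u : Rd d => (sobolevSymbol s u)⁻¹)) {ρ : Rd d → ℝ}
    (hρ : IsProbDensity ρ) {f : Rd d → ℂ} (hf : f ∈ sobolevSpace d s) :
    Integrable (fun x => f x * (ρ x : ℂ)) volume := by
  obtain ⟨a, -, ha⟩ := exists_eq_inner_evalFeature hI hf
  refine hρ.integrable.ofReal.bdd_mul
    (c := √(∫ u : Rd d, (sobolevSymbol s u)⁻¹) * ‖a‖) hf.1.aestronglyMeasurable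
    (.of_forall fun x => ?_)
  rw [ha x, ← norm_evalFeature hI x]
  exact norm_inner_le_norm _ _

/-- The error of the QMC algorithm is the pairing of `f` with the difference between the mean of the
feature map and its average over the points. -/
theorem norm_weightedIntegral_sub_qmc_le {d s n : ℕ} (hn : 1 ≤ n)
    (hI : Integrable (fun u : Rd d => (sobolevSymbol s u)⁻¹)) {ρ : Rd d → ℝ}
    (hρ : IsProbDensity ρ) {f : Rd d → ℂ} (hf : f ∈ sobolevUnitBall d s) (x : Fin n → Rd d) :
    ‖weightedIntegral ρ f - qmc x f‖
      ≤ 1 / n * ‖∑ j, (evalFeature hI (x j) - ∫ y, evalFeature hI y ∂densityMeasure ρ)‖ := by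
  have := hρ.isProbabilityMeasure
  obtain ⟨a, hnorm, ha⟩ := exists_eq_inner_evalFeature hI hf.1
  set m := ∫ y, evalFeature hI y ∂densityMeasure ρ
  have hn' : (n : ℂ) ≠ 0 := by exact_mod_cast (by omega : n ≠ 0)
  have h1 : weightedIntegral ρ f = inner ℂ m a := by
    rw [hρ.weightedIntegral_eq, ← inner_conj_symm,
      ← integral_inner (integrable_evalFeature hI _) a, ← integral_conj]
    congr 1 with y
    rw [ha y, inner_conj_symm]
  have h2 : weightedIntegral ρ f - qmc x f
      = -(1 / (n : ℂ)) * inner ℂ (∑ j, (evalFeature hI (x j) - m)) a := by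
    rw [h1, qmc, sum_inner]
    simp only [ha, inner_sub_left, Finset.sum_sub_distrib, Finset.sum_const, Finset.card_univ,
      Fintype.card_fin, nsmul_eq_mul]
    field_simp
    ring
  rw [h2, norm_mul, norm_neg, norm_div, norm_one, Complex.norm_natCast]
  refine mul_le_mul_of_nonneg_left ?_ (by positivity)
  refine (norm_inner_le_norm _ _).trans ?_
  exact mul_le_of_le_one_right (norm_nonneg _) (hnorm.trans_le hf.2)

/-- The constant is `10.03 = √100.6009`, from the bound for the kernel on the diagonal. -/
theorem exists_worstCaseError_qmc_le {d s : ℕ} {ρ : Rd d → ℝ} (hd : 1 ≤ d)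
    (hs : (d : ℝ) / 2 < s) (hρ : IsProbDensity ρ) {n : ℕ} (hn : 1 ≤ n) :
    ∃ x : Fin n → Rd d,
      worstCaseError s ρ (qmc x) ≤ ENNReal.ofReal (10.03 / √(n : ℝ) * (6 / 11 : ℝ) ^ d) := by
  obtain ⟨hI, hK⟩ := integrable_inv_sobolevSymbol_and_integral_le hd hs
  have := hρ.isProbabilityMeasure
  obtain ⟨x, hx⟩ := exists_norm_sum_sub_integral_sq_le
    (integrable_evalFeature hI (densityMeasure ρ)) (fun y => (norm_evalFeature_sq hI y).le) n
  refine ⟨x, iSup₂_le fun f hf => ?_⟩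
  rw [← ofReal_norm]
  refine ENNReal.ofReal_le_ofReal ((norm_weightedIntegral_sub_qmc_le hn hI hρ hf x).trans ?_)
  have hn0 : (0 : ℝ) < n := by exact_mod_cast hn
  have hsq : ‖∑ j, (evalFeature hI (x j) - ∫ y, evalFeature hI y ∂densityMeasure ρ)‖
      ≤ √n * (10.03 * (6 / 11 : ℝ) ^ d) := by
    refine abs_le_of_sq_le_sq' ?_ (by positivity) |>.2
    calc _ ≤ n * ∫ u : Rd d, (sobolevSymbol s u)⁻¹ := hx
      _ ≤ n * (100.6009 * (6 / 11 : ℝ) ^ (2 * d)) := by gcongr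
      _ = _ := by
        rw [mul_pow, mul_pow, Real.sq_sqrt hn0.le, ← pow_mul, mul_comm d 2]
        norm_num
  calc _ ≤ 1 / (n : ℝ) * (√n * (10.03 * (6 / 11 : ℝ) ^ d)) := by gcongr
    _ = _ := by
      nth_rw 1 [← Real.mul_self_sqrt hn0.le]
      field_simp

theorem infoComplexity_le_ceil {d s : ℕ} {ρ : Rd d → ℝ} (hd : 1 ≤ d)
    (hs : (d : ℝ) / 2 < s) (hρ : IsProbDensity ρ) {ε : ℝ} (hε : 0 < ε) :
    infoComplexity s ρ ε ≤
      (⌈(100.6009 : ℝ) * (6 / 11 : ℝ) ^ (2 * d) * (1 / ε ^ 2)⌉₊ : ℕ∞) := by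
  set n := ⌈(100.6009 : ℝ) * (6 / 11 : ℝ) ^ (2 * d) * (1 / ε ^ 2)⌉₊
  have hn : 1 ≤ n := Nat.one_le_ceil_iff.2 (by positivity)
  have hn0 : (0 : ℝ) < n := by exact_mod_cast hn
  obtain ⟨x, hx⟩ := exists_worstCaseError_qmc_le hd hs hρ hn
  refine iInf₂_le n ⟨qmc x, ⟨x, fun v => (1 / (n : ℂ)) * ∑ j, v j, fun f => rfl⟩, hx.trans ?_⟩
  refine ENNReal.ofReal_le_ofReal ?_
  have hle : (100.6009 : ℝ) * (6 / 11 : ℝ) ^ (2 * d) * (1 / ε ^ 2) ≤ n := Nat.le_ceil _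
  rw [mul_one_div, div_le_iff₀ (by positivity)] at hle
  rw [div_mul_eq_mul_div, div_le_iff₀ (by positivity)]
  refine abs_le_of_sq_le_sq' ?_ (by positivity) |>.2
  rw [mul_pow, mul_pow, Real.sq_sqrt hn0.le, ← pow_mul, mul_comm d 2]
  norm_num at hle ⊢
  linarith

/-- Rounding up to an integer costs at most `1 < ε⁻²`. -/
theorem infoComplexity_le_inv_sq {d s : ℕ} {ρ : Rd d → ℝ} (hd : 1 ≤ d)
    (hs : (d : ℝ) / 2 < s) (hρ : IsProbDensity ρ) {ε : ℝ} (hε : 0 < ε) (hε1 : ε < 1) :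
    (infoComplexity s ρ ε : ℝ≥0∞) ≤ ENNReal.ofReal (102 * (1 / ε ^ 2)) := by
  have h := infoComplexity_le_ceil hd hs hρ hε
  refine (ENat.toENNReal_le.2 h).trans ?_
  rw [ENat.toENNReal_coe, ← ENNReal.ofReal_natCast]
  refine ENNReal.ofReal_le_ofReal ((Nat.ceil_lt_add_one (by positivity)).le.trans ?_)
  have h1 : (1 : ℝ) ≤ 1 / ε ^ 2 := by
    rw [le_div_iff₀ (by positivity)]
    nlinarith
  have h2 : (6 / 11 : ℝ) ^ (2 * d) ≤ 1 := pow_le_one₀ (by norm_num) (by norm_num)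
  calc _ ≤ (100.6009 : ℝ) * 1 * (1 / ε ^ 2) + 1 * (1 / ε ^ 2) := by
        rw [one_mul]
        gcongr
    _ ≤ _ := by linarith

theorem mainTheorem4 :
    -- the bounds for each dimension, smoothness and density
    (∀ (d s : ℕ) (ρ : Rd d → ℝ), 1 ≤ d → (d : ℝ) / 2 < s → IsProbDensity ρ →
      (∀ f ∈ sobolevSpace d s, Integrable (fun x => f x * (ρ x : ℂ)) volume) ∧
      (∀ n : ℕ, 1 ≤ n → ∃ x : Fin n → Rd d,
        worstCaseError s ρ (qmc x) ≤ ENNReal.ofReal (10.03 / √(n : ℝ) * (6 / 11 : ℝ) ^ d)) ∧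
      (∀ ε : ℝ, 0 < ε →
        infoComplexity s ρ ε ≤
          (⌈(100.6009 : ℝ) * (6 / 11 : ℝ) ^ (2 * d) * (1 / ε ^ 2)⌉₊ : ℕ∞))) ∧
    -- a bound of order `ε⁻²` with a factor independent of dimension, smoothness and density
    (∃ C : ℝ, 0 ≤ C ∧ ∀ (d s : ℕ) (ρ : Rd d → ℝ), 1 ≤ d → (d : ℝ) / 2 < s → IsProbDensity ρ →
      ∀ ε : ℝ, 0 < ε → ε < 1 →
        (infoComplexity s ρ ε : ℝ≥0∞) ≤ ENNReal.ofReal (C * (1 / ε ^ 2))) ∧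
    -- strong polynomial tractability for all choices of smoothness and densities
    (∀ (s : ℕ → ℕ) (ρ : ∀ d : ℕ, Rd d → ℝ),
      (∀ d : ℕ, 1 ≤ d → (d : ℝ) / 2 < s d ∧ IsProbDensity (ρ d)) →
      StronglyPolynomiallyTractable fun d ε => infoComplexity (s d) (ρ d) ε) := by
  refine ⟨fun d s ρ hd hs hρ => ⟨fun f hf => ?_, fun n hn => ?_, fun ε hε => ?_⟩,
    ⟨102, by norm_num, fun d s ρ hd hs hρ ε hε hε1 => ?_⟩, fun s ρ h => ?_⟩
  · exact integrable_mul_density (integrable_inv_sobolevSymbol_and_integral_le hd hs).1 hρ hf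
  · exact exists_worstCaseError_qmc_le hd hs hρ hn
  · exact infoComplexity_le_ceil hd hs hρ hε
  · exact infoComplexity_le_inv_sq hd hs hρ hε hε1
  · refine ⟨102, 2, by norm_num, by norm_num, fun d hd ε hε hε1 => ?_⟩
    have hpow : ε ^ (-2 : ℝ) = 1 / ε ^ 2 := by
      rw [Real.rpow_neg hε.le, Real.rpow_two, one_div]
    rw [hpow]
    exact infoComplexity_le_inv_sq hd (h d hd).1 (h d hd).2 hε hε1
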